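/- For a commutative ring $R$ with $1$ and $n\ge 1$ let ${\rm Sp}_{2n}(R)=\{A\in R^{2n\times 2n}\mid A^TJA=J\}$, where $J=\begin{pmatrix}0&I_n\\-I_n&0\end{pmatrix}$. For a group $G$ and a finite subset $S\subset G$ that normally generates $G$ (i.e. the conjugates of the elements of $S$ generate $G$), let $\|g\|_S$ be the least length of a product of conjugates of elements of $S\cup S^{-1}$ that equals $g\in G$ (with $\|1\|_S=0$), and let $\|G\|_S$ be the least integer $N\geq 0$ such that $\|g\|_S\le N$ for all $g\in G$, or $+\infty$ if there is no such $N$. For a positive integer $k$ let $$\Delta_k(G):=\sup\{\|G\|_S \mid S\subset G,\ |S|\le k,\ S \text{ normally generates } G\},$$ with $\Delta_k(G):=-\infty$ if there is no such $S$. Theorem. Let $R$ be a principal ideal domain with precisely $q\in\mathbb{N}$ maximal ideals, and let $n\ge 3$ and $k\ge 1$ be integers. Then 1. $\Delta_k({\rm Sp}_{2n}(R))\le 576(3n-2)\min\{q,5nk\}$; 2. if $k\le q$, then $\Delta_k({\rm Sp}_{2n}(R))\ge 2nk$; 3. if $k\ge q+1$, then $\Delta_k({\rm Sp}_{2n}(R))\ge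 2nq$. -/

import Mathlib

open scoped Pointwise

namespace ConjWordNorm

variable {G : Type*} [Group G]

/-- The conjugation word norm `‖g‖_S` on a group `G`: the least length of a word in the conjugates
of the elements of `S` and their inverses whose product is `g` (so `‖1‖_S = 0`). It is `⊤` if there
is no such word, which does not happen when `S` normally generates `G`. -/
noncomputable def wordNorm (S : Set G) (g : G) : ℕ∞ :=
  sInf {N : ℕ∞ | ∃ w : List G,
    (∀ x ∈ w, x ∈ Group.conjugatesOfSet (S ∪ S⁻¹)) ∧ w.prod = g ∧ (w.length : ℕ∞) = N}

/-- The ball `B_S(N)` of all elements of conjugation word norm at most `N`. -/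
def ball (S : Set G) (N : ℕ) : Set G :=
  {g : G | wordNorm S g ≤ (N : ℕ∞)}

/-- The diameter `‖G‖_S`: the least `N` with `B_S(N) = G`, and `⊤` if there is none. -/
noncomputable def diam (S : Set G) : ℕ∞ :=
  sInf {d : ℕ∞ | ∃ N : ℕ, ball S N = Set.univ ∧ (N : ℕ∞) = d}

/-- `Δ_k(G)`: the supremum of the diameters `‖G‖_S` over all normally generating subsets `S` of `G`
with at most `k` elements. It is `⊥` (that is, `-∞`) if there is no such `S`. -/
noncomputable def Delta (k : ℕ) (G : Type*) [Group G] : WithBot ℕ∞ :=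
  sSup {d : WithBot ℕ∞ | ∃ S : Set G,
    S.encard ≤ (k : ℕ∞) ∧ Subgroup.normalClosure S = ⊤ ∧ ((diam S : ℕ∞) : WithBot ℕ∞) = d}

end ConjWordNorm

/-!
Write `ω` for the symplectic form on `R²ⁿ`, `T(v, a)` for the transvection `x ↦ x + a ω(v, x) v`,
and `E(u, v)` for the Eichler transformation `x ↦ x + ω(u, x) v + ω(v, x) u` of orthogonal vectors.

**Upper bound.** Since `R` is semilocal, a unimodular vector is moved to any other by two
transvections (`exists_two_transvections_act_eq`), so that all transvections `T(v, a)` with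
unimodular `v` and fixed `a` are conjugate, and five transvections per hyperbolic pair reduce any
matrix to the identity (`isProd_of_forall_transvection`). It remains to write a transvection as a
short product of conjugates of the generators.

If `S` normally generates, every maximal ideal `m` has an `A ∈ S` that is not scalar modulo `m`
(`exists_notMem_scalarMod`). One choice for each `m` uses at most `min q k` matrices `A`. Given such
an `A`, the Chinese remainder theorem yields a unimodular `p` such that `A p` leaves the line of `p`
modulo each `m` for which `A` is not scalar; after a conjugation `p = e₁` and
`A e₁ = α e₁ + β f₁ + γ e₂`, with `β` and `γ` not both in `m`. As `n ≥ 3`, the vector `e₃` is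
orthogonal to `e₁` and to `A e₁`, and three nested commutators produce `E(e₂, s d e₃)` from eight
conjugates of `A` and its inverse, where `(d) = (β, γ)` and `s` is arbitrary (`isProd_eichler`). One
more commutator turns this into `T(e₃, a d²)`, at the price of 24 conjugates
(`isProd_transvection_mul_sq`). The numbers `d²` for the different `A` generate the unit ideal, and
the parameters of transvections along `e₃` add up, so every transvection is a product of
`24 min q k` conjugates, and every matrix one of `120 n min q k`, which is within the bound claimed.
The same argument shows that any finite set with a nonscalar matrix modulo each maximal ideal
normally generates (`normalClosure_eq_top`).

**Lower bound.** For `k ≤ q` split the maximal ideals into `k` nonempty classes and choose `rᵢ` that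
lies outside exactly the ideals of the `i`-th class. The transvections `T(e₁, rᵢ)` normally generate.
The rank of `B - 1` over a residue field is subadditive in `B` and a conjugation invariant. A
conjugate of a generator contributes at most `1` to the sum of these ranks over representatives of
the `k` classes, whereas a matrix with `B - 1` invertible has the sum `2nk`
(`le_Delta_symplecticGroup`). For `k > q` the bound for `k = q` applies, as `Δ_k` is monotone in `k`.
-/

namespace ConjWordNorm

variable {G : Type*} [Group G]

/-! ### Conjugation word norms -/

/-- `g` is a product of at most `N` conjugates of elements of `S ∪ S⁻¹`. -/
def IsProd (S : Set G) (N : ℕ) (g : G) : Prop :=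
  ∃ w : List G, (∀ x ∈ w, x ∈ Group.conjugatesOfSet (S ∪ S⁻¹)) ∧ w.prod = g ∧ w.length ≤ N

theorem inv_mem_conjugatesOfSet_union_inv {S : Set G} {x : G}
    (hx : x ∈ Group.conjugatesOfSet (S ∪ S⁻¹)) : x⁻¹ ∈ Group.conjugatesOfSet (S ∪ S⁻¹) := by
  rw [Group.mem_conjugatesOfSet_iff] at hx ⊢
  obtain ⟨a, ha, hax⟩ := hx
  obtain ⟨c, rfl⟩ := isConj_iff.1 hax
  refine ⟨a⁻¹, ?_, isConj_iff.2 ⟨c, by group⟩⟩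
  rcases ha with ha | ha
  · exact Or.inr (by simpa using ha)
  · exact Or.inl ha

namespace IsProd

variable {S : Set G} {N N' : ℕ} {g h : G}

theorem mono (hg : IsProd S N g) (hN : N ≤ N') : IsProd S N' g := by
  obtain ⟨w, h1, h2, h3⟩ := hg
  exact ⟨w, h1, h2, h3.trans hN⟩

theorem one : IsProd S 0 (1 : G) := ⟨[], by simp⟩

theorem of_mem (hg : g ∈ S) : IsProd S 1 g :=
  ⟨[g], by simpa using Group.subset_conjugatesOfSet (s := S ∪ S⁻¹) (Or.inl hg), by simp⟩

theorem mul (hg : IsProd S N g) (hh : IsProd S N' h) : IsProd S (N + N') (g * h) := by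
  obtain ⟨w, h1, rfl, h3⟩ := hg
  obtain ⟨w', h1', rfl, h3'⟩ := hh
  refine ⟨w ++ w', fun x hx => ?_, by simp, by simpa using Nat.add_le_add h3 h3'⟩
  rcases List.mem_append.1 hx with hx | hx
  exacts [h1 x hx, h1' x hx]

theorem inv (hg : IsProd S N g) : IsProd S N g⁻¹ := by
  obtain ⟨w, h1, rfl, h3⟩ := hg
  refine ⟨(w.map fun x => x⁻¹).reverse, fun x hx => ?_, (List.prod_inv_reverse w).symm, by simpa⟩
  obtain ⟨y, hy, rfl⟩ := List.mem_map.1 (List.mem_reverse.1 hx)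
  exact inv_mem_conjugatesOfSet_union_inv (h1 y hy)

theorem conj (hg : IsProd S N g) (h : G) : IsProd S N (h * g * h⁻¹) := by
  obtain ⟨w, h1, rfl, h3⟩ := hg
  refine ⟨w.map (MulAut.conj h), fun x hx => ?_, ?_, by simpa⟩
  · obtain ⟨y, hy, rfl⟩ := List.mem_map.1 hx
    exact Group.conj_mem_conjugatesOfSet (h1 y hy)
  · rw [← map_list_prod, MulAut.conj_apply]

theorem of_conj (h : G) (hg : IsProd S N (h * g * h⁻¹)) : IsProd S N g := by
  simpa [mul_assoc] using hg.conj h⁻¹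

/-- A commutator `g h g⁻¹ h⁻¹` is the product of `g` and a conjugate of `g⁻¹`. -/
theorem commutator (hg : IsProd S N g) (h : G) : IsProd S (N + N) (g * (h * g⁻¹ * h⁻¹)) :=
  hg.mul (hg.inv.conj h)

theorem finset_prod {ι : Type*} [DecidableEq ι] (s : Finset ι) {H : Type*} [AddCommMonoid H]
    (T : Multiplicative H →* G) (f : ι → H)
    (hf : ∀ i ∈ s, IsProd S N (T (.ofAdd (f i)))) :
    IsProd S (N * s.card) (T (.ofAdd (∑ i ∈ s, f i))) := by
  induction s using Finset.induction_on with
  | empty => simpa using one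
  | insert i s hi ih =>
    rw [Finset.sum_insert hi, Finset.card_insert_of_notMem hi, ofAdd_add, map_mul, mul_add_one,
      add_comm]
    exact (hf i (by simp)).mul (ih fun j hj => hf j (by simp [hj]))

theorem mem_normalClosure (hg : IsProd S N g) : g ∈ Subgroup.normalClosure S := by
  obtain ⟨w, h1, rfl, -⟩ := hg
  refine Subgroup.list_prod_mem _ fun x hx => ?_
  obtain ⟨a, ha, hax⟩ := Group.mem_conjugatesOfSet_iff.1 (h1 x hx)
  obtain ⟨c, rfl⟩ := isConj_iff.1 hax
  refine Subgroup.normalClosure_normal.conj_mem _ ?_ c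
  rcases ha with ha | ha
  · exact Subgroup.subset_normalClosure ha
  · exact inv_mem_iff.1 (Subgroup.subset_normalClosure ha)

end IsProd

theorem diam_le {S : Set G} {N : ℕ} (h : ∀ g, IsProd S N g) : diam S ≤ N := by
  refine sInf_le ⟨N, Set.eq_univ_of_forall fun g => ?_, rfl⟩
  obtain ⟨w, h1, h2, h3⟩ := h g
  exact (sInf_le ⟨w, h1, h2, rfl⟩ : wordNorm S g ≤ _).trans (by exact_mod_cast h3)

theorem le_diam {S : Set G} {N : ℕ} (g : G)
    (h : ∀ w : List G, (∀ x ∈ w, x ∈ Group.conjugatesOfSet (S ∪ S⁻¹)) → w.prod = g →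
      N ≤ w.length) : (N : ℕ∞) ≤ diam S := by
  refine le_sInf ?_
  rintro _ ⟨M, hM, rfl⟩
  have hg : g ∈ ball S M := hM ▸ Set.mem_univ g
  refine le_trans (le_sInf ?_) (show wordNorm S g ≤ M from hg)
  rintro _ ⟨w, h1, h2, rfl⟩
  exact_mod_cast h w h1 h2

theorem Delta_mono {k l : ℕ} (h : k ≤ l) : Delta k G ≤ Delta l G := by
  refine sSup_le_sSup ?_
  rintro d ⟨S, hS, hd⟩
  exact ⟨S, hS.trans (by exact_mod_cast h), hd⟩

end ConjWordNorm

namespace SymplecticTransvection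

open Matrix ConjWordNorm

variable {R : Type*} [CommRing R] {n : ℕ}

/-! ### The symplectic form and transvections -/

/-- The symplectic form on `R²ⁿ`, with the sign for which `form (e i) (f i) = 1`. -/
def form : LinearMap.BilinForm R (Fin n ⊕ Fin n → R) := Matrix.toBilin' (-J (Fin n) R)

/-- The first half of the symplectic basis. -/
def e (i : Fin n) : Fin n ⊕ Fin n → R := Pi.single (Sum.inl i) 1

/-- The second half of the symplectic basis. -/
def f (i : Fin n) : Fin n ⊕ Fin n → R := Pi.single (Sum.inr i) 1

theorem form_apply (x y : Fin n ⊕ Fin n → R) : form x y = -(x ⬝ᵥ J (Fin n) R *ᵥ y) := by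
  simp [form, Matrix.toBilin'_apply']

theorem form_mulVec (A : Matrix (Fin n ⊕ Fin n) (Fin n ⊕ Fin n) R) (x y : Fin n ⊕ Fin n → R) :
    form (A *ᵥ x) (A *ᵥ y) = -(x ⬝ᵥ (Aᵀ * J (Fin n) R * A) *ᵥ y) := by
  rw [form_apply, ← Matrix.vecMul_transpose A x, ← Matrix.dotProduct_mulVec, Matrix.mulVec_mulVec,
    Matrix.mulVec_mulVec, Matrix.mul_assoc]

@[simp]
theorem form_e_e (i j : Fin n) : form (e i : _ → R) (e j) = 0 := by
  rw [form, e, e, Matrix.toBilin'_single]; simp [J]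

@[simp]
theorem form_f_f (i j : Fin n) : form (f i : _ → R) (f j) = 0 := by
  rw [form, f, f, Matrix.toBilin'_single]; simp [J]

theorem form_e_f (i j : Fin n) : form (e i : _ → R) (f j) = if i = j then 1 else 0 := by
  rw [form, e, f, Matrix.toBilin'_single]; simp [J, Matrix.one_apply]

theorem form_f_e (i j : Fin n) : form (f i : _ → R) (e j) = -if i = j then 1 else 0 := by
  rw [form, e, f, Matrix.toBilin'_single]; simp [J, Matrix.one_apply]

theorem form_eq_sum (x y : Fin n ⊕ Fin n → R) :
    form x y = ∑ i, x (Sum.inl i) * y (Sum.inr i) - ∑ i, x (Sum.inr i) * y (Sum.inl i) := by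
  rw [form_apply, J, Matrix.fromBlocks_mulVec, dotProduct, Fintype.sum_sum_type]
  simp [Matrix.neg_mulVec]
  ring

@[simp]
theorem form_self (x : Fin n ⊕ Fin n → R) : form x x = 0 := by
  rw [form_eq_sum, sub_eq_zero]
  exact Finset.sum_congr rfl fun i _ => mul_comm _ _

theorem form_swap (x y : Fin n ⊕ Fin n → R) : form x y = -form y x := by
  rw [form_eq_sum, form_eq_sum, neg_sub]
  simp [mul_comm]

theorem form_f_right (x : Fin n ⊕ Fin n → R) (i : Fin n) : form x (f i) = x (Sum.inl i) := by
  rw [form_eq_sum]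
  simp [f, Pi.single_apply]

theorem form_e_right (x : Fin n ⊕ Fin n → R) (i : Fin n) : form x (e i) = -x (Sum.inr i) := by
  rw [form_eq_sum]
  simp [e, Pi.single_apply]

/-- The action of a symplectic matrix on column vectors. -/
def act (A : symplecticGroup (Fin n) R) :
    (Fin n ⊕ Fin n → R) →ₗ[R] (Fin n ⊕ Fin n → R) := A.1.mulVecLin

@[simp]
theorem act_one (x : Fin n ⊕ Fin n → R) : act 1 x = x := by simp [act]

@[simp]
theorem act_mul (A B : symplecticGroup (Fin n) R) (x : Fin n ⊕ Fin n → R) :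
    act (A * B) x = act A (act B x) := by simp [act]

theorem ext_act {A B : symplecticGroup (Fin n) R} (h : ∀ x, act A x = act B x) : A = B :=
  Subtype.ext (Matrix.toLin'.injective (LinearMap.ext h))

@[simp]
theorem act_inv_act (A : symplecticGroup (Fin n) R) (x : Fin n ⊕ Fin n → R) :
    act A⁻¹ (act A x) = x := by rw [← act_mul, inv_mul_cancel, act_one]

@[simp]
theorem act_act_inv (A : symplecticGroup (Fin n) R) (x : Fin n ⊕ Fin n → R) :
    act A (act A⁻¹ x) = x := by rw [← act_mul, mul_inv_cancel, act_one]

@[simp]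
theorem form_act (A : symplecticGroup (Fin n) R) (x y : Fin n ⊕ Fin n → R) :
    form (act A x) (act A y) = form x y := by
  rw [act, Matrix.mulVecLin_apply, Matrix.mulVecLin_apply, form_mulVec,
    SymplecticGroup.mem_iff'.1 A.2, form_apply]

theorem form_act_left (A : symplecticGroup (Fin n) R) (x y : Fin n ⊕ Fin n → R) :
    form (act A x) y = form x (act A⁻¹ y) := by
  rw [← form_act A x, act_act_inv]

/-- The symplectic matrix of a linear map that preserves the symplectic form. -/
def ofIsometry (L : (Fin n ⊕ Fin n → R) →ₗ[R] (Fin n ⊕ Fin n → R))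
    (h : ∀ x y, form (L x) (L y) = form x y) : symplecticGroup (Fin n) R :=
  ⟨LinearMap.toMatrix' L, by
    rw [SymplecticGroup.mem_iff', ← neg_inj]
    refine Matrix.toBilin'.injective (LinearMap.ext₂ fun x y => ?_)
    refine Eq.trans ?_ (h x y)
    rw [← LinearMap.toMatrix'_mulVec, ← LinearMap.toMatrix'_mulVec L y, form_mulVec,
      Matrix.toBilin'_apply', Matrix.neg_mulVec, dotProduct_neg]⟩

@[simp]
theorem act_ofIsometry (L : (Fin n ⊕ Fin n → R) →ₗ[R] (Fin n ⊕ Fin n → R))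
    (h : ∀ x y, form (L x) (L y) = form x y) (x) : act (ofIsometry L h) x = L x := by
  simp [act, ofIsometry]

/-- The transvection `x ↦ x + a ω(v, x) v`. -/
def transvection (v : Fin n ⊕ Fin n → R) (a : R) : symplecticGroup (Fin n) R :=
  ofIsometry (LinearMap.id + (a • form v).smulRight v) fun x y => by
    simp [form_swap x v]; ring

@[simp]
theorem act_transvection (v : Fin n ⊕ Fin n → R) (a : R) (x : Fin n ⊕ Fin n → R) :
    act (transvection v a) x = x + (a * form v x) • v := by
  simp [transvection]

theorem transvection_add (v : Fin n ⊕ Fin n → R) (a b : R) :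
    transvection v (a + b) = transvection v a * transvection v b := by
  refine ext_act fun x => ?_
  simp
  module

@[simp]
theorem transvection_zero (v : Fin n ⊕ Fin n → R) : transvection v (0 : R) = 1 :=
  ext_act fun x => by simp

theorem transvection_neg (v : Fin n ⊕ Fin n → R) (a : R) :
    transvection v (-a) = (transvection v a)⁻¹ := by
  rw [eq_inv_iff_mul_eq_one, ← transvection_add, neg_add_cancel, transvection_zero]

theorem conj_transvection (g : symplecticGroup (Fin n) R) (v : Fin n ⊕ Fin n → R) (a : R) :
    g * transvection v a * g⁻¹ = transvection (act g v) a := by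
  refine ext_act fun x => ?_
  simp [form_act_left]

/-- The Eichler transformation `x ↦ x + ω(u, x) v + ω(v, x) u` attached to orthogonal vectors `u`
and `v`. The product of transvections defining it makes sense for all `u` and `v`. -/
def eichler (u v : Fin n ⊕ Fin n → R) : symplecticGroup (Fin n) R :=
  transvection (u + v) 1 * transvection u (-1) * transvection v (-1)

theorem act_eichler {u v : Fin n ⊕ Fin n → R} (h : form u v = 0) (x : Fin n ⊕ Fin n → R) :
    act (eichler u v) x = x + form u x • v + form v x • u := by
  have h' : form v u = 0 := by rw [form_swap, h, neg_zero]
  simp [eichler, h, h']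
  module

theorem conj_eichler (g : symplecticGroup (Fin n) R) (u v : Fin n ⊕ Fin n → R) :
    g * eichler u v * g⁻¹ = eichler (act g u) (act g v) := by
  simp only [eichler, ← map_add, ← conj_transvection]
  group

/-! ### Extracting a transvection from a matrix -/

/-- If `B` maps `v` to `e i`, then commuting `B` with a transvection along `v`, then with an
Eichler transformation that fixes `v` and shifts `e i` by a multiple of `e k`, and then with one
that shifts `e i` by `e j`, leaves an Eichler transformation along `e j` and `e k`. -/
theorem isProd_eichler {S : Set (symplecticGroup (Fin n) R)} {B : symplecticGroup (Fin n) R}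
    {i j k : Fin n} (hij : i ≠ j) (hik : i ≠ k) {v y : Fin n ⊕ Fin n → R} {d : R}
    (hB : IsProd S 1 B) (hv : act B v = e i) (hkv : form (e k) v = 0) (hyv : form y v = 0)
    (hyk : form y (e k) = 0) (hyd : form y (e i) = d) (s : R) :
    IsProd S 8 (eichler (e j) ((s * d) • e k)) := by
  have h1 := hB.commutator (transvection v (-s))
  have h2 := h1.commutator (eichler y (e k))
  have hF : B * (transvection v (-s) * B⁻¹ * (transvection v (-s))⁻¹) *
      (eichler y (e k) * (B * (transvection v (-s) * B⁻¹ * (transvection v (-s))⁻¹))⁻¹ *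
        (eichler y (e k))⁻¹) = transvection (e i) (-s) * transvection (e i + d • e k) s := by
    have e1 : B * (transvection v (-s) * B⁻¹ * (transvection v (-s))⁻¹) =
        transvection (e i) (-s) * transvection v s := by
      rw [← hv, ← conj_transvection, ← transvection_neg, neg_neg]
      group
    have e2 : eichler y (e k) * (transvection (e i) (-s) * transvection v s)⁻¹ *
        (eichler y (e k))⁻¹ = transvection v (-s) * transvection (e i + d • e k) s := by
      rw [_root_.mul_inv_rev, ← transvection_neg, ← transvection_neg, neg_neg]
      have e3 : act (eichler y (e k)) v = v := by simp [act_eichler hyk, hyv, hkv]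
      have e4 : act (eichler y (e k)) (e i) = e i + d • e k := by simp [act_eichler hyk, hyd]
      rw [← e4, ← conj_transvection]
      nth_rewrite 2 [← e3]
      rw [← conj_transvection]
      group
    rw [e1, e2, transvection_neg v]
    group
  rw [hF] at h2
  have hfj : form (-f i : Fin n ⊕ Fin n → R) (e j) = 0 := by simp [form_f_e, hij]
  have h3 := (h2.conj (eichler (-f i) (e j))).mul h2.inv
  convert h3 using 1
  refine ext_act fun x => ?_
  have e1 : act (eichler (-f i) (e j)) (e i : _ → R) = e i + e j := by
    simp [act_eichler hfj, form_f_e]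
  have e2 : act (eichler (-f i) (e j)) (e k : _ → R) = e k := by
    simp [act_eichler hfj, form_f_e, hik]
  rw [_root_.mul_inv_rev, ← transvection_neg, ← transvection_neg, neg_neg,
    show ∀ g a b : symplecticGroup (Fin n) R, g * (a * b) * g⁻¹ = g * a * g⁻¹ * (g * b * g⁻¹) by
      intro g a b; group]
  simp only [conj_transvection, map_add, map_smul, e1, e2]
  simp [act_eichler]
  module

/-- The commutator of a transvection along `f j` with an Eichler transformation along `e j` and
`e k` is a transvection along `e k`, up to another Eichler transformation. -/
theorem isProd_transvection_mul_sq {S : Set (symplecticGroup (Fin n) R)} {j k : Fin n} (hjk : j ≠ k)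
    {d : R} (h : ∀ s, IsProd S 8 (eichler (e j) ((s * d) • e k))) (a : R) :
    IsProd S 24 (transvection (e k) (a * d ^ 2)) := by
  have h1 : IsProd S 16 (transvection (f j) (-a) * transvection (f j + d • e k) a) := by
    have h1 := (((h 1).conj (transvection (f j) (-a))).mul (h 1).inv)
    have e1 : act (eichler (e j) ((1 * d) • e k)) (f j : _ → R) = f j + d • e k := by
      simp [act_eichler, form_e_f, hjk.symm]
    rw [← e1, ← conj_transvection]
    convert h1 using 1
    rw [transvection_neg]
    group
  -- The transvection along `f j - e j` maps `e j` to `f j` and fixes `e k`.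
  have h2 := (h (-a)).conj (transvection (f j - e j) (-1))
  convert h1.mul h2 using 1
  refine ext_act fun x => ?_
  have e1 : act (transvection (f j - e j) (-1)) (e j : _ → R) = f j := by
    simp [form_f_e]
  have e2 : act (transvection (f j - e j) (-1)) (e k : _ → R) = e k := by
    simp [form_f_e, hjk]
  rw [conj_eichler, map_smul, e1, e2]
  simp [act_eichler, form_f_e, form_e_f, hjk, hjk.symm]
  module

/-! ### Approximation over semilocal rings -/

theorem exists_forall_sub_mem [Finite (MaximalSpectrum R)] (ρ : MaximalSpectrum R → R) :
    ∃ r, ∀ m, r - ρ m ∈ m.asIdeal := by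
  refine Ideal.exists_forall_sub_mem_ideal (fun m m' h => ?_) ρ
  exact Ideal.isCoprime_iff_sup_eq.2
    (m.isMaximal.coprime_of_ne m'.isMaximal fun h' => h (MaximalSpectrum.ext h'))

theorem exists_forall_map_sub_mem [Finite (MaximalSpectrum R)] {V : Type*} [AddCommGroup V]
    [Module R V] (x : MaximalSpectrum R → V) :
    ∃ z ∈ Submodule.span R (Set.range x), ∀ (φ : V →ₗ[R] R) (m : MaximalSpectrum R),
      φ z - φ (x m) ∈ m.asIdeal := by
  classical
  cases nonempty_fintype (MaximalSpectrum R)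
  choose c hc using fun m : MaximalSpectrum R =>
    exists_forall_sub_mem (R := R) fun m' => if m' = m then 1 else 0
  refine ⟨∑ m, c m • x m, Submodule.sum_mem _ fun m _ =>
    Submodule.smul_mem _ _ (Submodule.subset_span ⟨m, rfl⟩), fun φ m => ?_⟩
  have : φ (∑ m, c m • x m) - φ (x m) = ∑ m', (c m' - if m = m' then 1 else 0) * φ (x m') := by
    simp [sub_mul]
  rw [this]
  exact Ideal.sum_mem _ fun m' _ => Ideal.mul_mem_right _ _ (hc m' m)

theorem isUnit_of_forall_notMem {r : R} (h : ∀ m : MaximalSpectrum R, r ∉ m.asIdeal) :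
    IsUnit r := by
  by_contra hr
  obtain ⟨I, hI, hrI⟩ := exists_max_ideal_of_mem_nonunits hr
  exact h ⟨I, hI⟩ hrI

theorem notMem_of_eq_one {r : R} (h : r = 1) (m : MaximalSpectrum R) : r ∉ m.asIdeal :=
  fun hr => m.isMaximal.ne_top ((Ideal.eq_top_iff_one _).2 (h ▸ hr))

/-- No vector space is the union of two hyperplanes; lifted to a semilocal ring. -/
theorem exists_isUnit_form_both [Finite (MaximalSpectrum R)]
    (W : Submodule R (Fin n ⊕ Fin n → R)) {v w v' w' : Fin n ⊕ Fin n → R}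
    (hv' : v' ∈ W) (hw' : w' ∈ W) (hv : form v v' = 1) (hw : form w w' = 1) :
    ∃ z ∈ W, IsUnit (form v z) ∧ IsUnit (form w z) := by
  have key : ∀ m : MaximalSpectrum R, ∃ z ∈ W, form v z ∉ m.asIdeal ∧ form w z ∉ m.asIdeal := by
    intro m
    by_cases h1 : form w v' ∈ m.asIdeal
    · by_cases h2 : form v w' ∈ m.asIdeal
      · refine ⟨v' + w', W.add_mem hv' hw', fun h => ?_, fun h => ?_⟩
        · rw [map_add, Ideal.add_mem_iff_left _ h2] at h
          exact notMem_of_eq_one hv m h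
        · rw [map_add, Ideal.add_mem_iff_right _ h1] at h
          exact notMem_of_eq_one hw m h
      · exact ⟨w', hw', h2, notMem_of_eq_one hw m⟩
    · exact ⟨v', hv', notMem_of_eq_one hv m, h1⟩
  choose x hxW hx using key
  obtain ⟨z, hz, hzx⟩ := exists_forall_map_sub_mem x
  refine ⟨z, Submodule.span_le.2 (by rintro _ ⟨m, rfl⟩; exact hxW m) hz,
    isUnit_of_forall_notMem fun m hm => (hx m).1 ?_, isUnit_of_forall_notMem fun m hm => (hx m).2 ?_⟩
  · exact (Submodule.sub_mem_iff_right _ hm).1 (hzx (form v) m)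
  · exact (Submodule.sub_mem_iff_right _ hm).1 (hzx (form w) m)

/-! ### Generation by transvections -/

/-- A vector is unimodular if the symplectic form pairs it to `1` with some vector. -/
def IsUnimodular (v : Fin n ⊕ Fin n → R) : Prop := ∃ y, form v y = 1

theorem isUnimodular_of_isUnit {v y : Fin n ⊕ Fin n → R} (h : IsUnit (form v y)) :
    IsUnimodular v := by
  obtain ⟨b, hb⟩ := h.exists_right_inv
  exact ⟨b • y, by simpa [mul_comm] using hb⟩

theorem isUnimodular_e (i : Fin n) : IsUnimodular (e i : _ → R) := ⟨f i, by simp [form_e_f]⟩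

theorem exists_transvection_act_eq {v w : Fin n ⊕ Fin n → R} (h : IsUnit (form v w)) :
    IsUnimodular (w - v) ∧ ∃ a, act (transvection (w - v) a) v = w := by
  constructor
  · refine isUnimodular_of_isUnit (y := v) ?_
    simpa [form_swap w v] using h
  · obtain ⟨b, hb⟩ := h.exists_right_inv
    refine ⟨-b, ?_⟩
    have : -b * form (w - v) v = 1 := by
      rw [← hb]; simp [form_swap w v, mul_comm]
    simp [this, -map_sub, -LinearMap.sub_apply, -neg_mul]

/-- Two transvections, through an intermediate vector that is not orthogonal to either end modulo
any maximal ideal, move a unimodular vector to any other. -/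
theorem exists_two_transvections_act_eq [Finite (MaximalSpectrum R)]
    (W : Submodule R (Fin n ⊕ Fin n → R)) {v w v' w' : Fin n ⊕ Fin n → R}
    (hvW : v ∈ W) (hwW : w ∈ W) (hv' : v' ∈ W) (hw' : w' ∈ W)
    (hv : form v v' = 1) (hw : form w w' = 1) :
    ∃ u₁ ∈ W, ∃ u₂ ∈ W, ∃ a₁ a₂, IsUnimodular u₁ ∧ IsUnimodular u₂ ∧
      act (transvection u₂ a₂ * transvection u₁ a₁) v = w := by
  obtain ⟨z, hzW, hvz, hwz⟩ := exists_isUnit_form_both W hv' hw' hv hw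
  obtain ⟨h1, a, ha⟩ := exists_transvection_act_eq hvz
  have hzw : IsUnit (form z w) := by rwa [form_swap, IsUnit.neg_iff]
  obtain ⟨h2, b, hb⟩ := exists_transvection_act_eq hzw
  exact ⟨z - v, W.sub_mem hzW hvW, w - z, W.sub_mem hwW hzW, a, b, h1, h2, by rw [act_mul, ha, hb]⟩

/-- The orthogonal complement of the first `t` hyperbolic pairs. -/
def perp (R : Type*) [CommRing R] {n : ℕ} (t : ℕ) : Submodule R (Fin n ⊕ Fin n → R) where
  carrier := {x | ∀ i : Fin n, i.val < t → form x (e i) = 0 ∧ form x (f i) = 0}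
  add_mem' hx hy i hi := by simp [hx i hi, hy i hi]
  zero_mem' i _ := by simp
  smul_mem' c x hx i hi := by simp [hx i hi]

theorem eq_one_of_fixes {g : symplecticGroup (Fin n) R}
    (h : ∀ i, act g (e i) = e i ∧ act g (f i) = f i) : g = 1 := by
  refine ext_act fun x => ?_
  rw [act_one]
  refine LinearMap.congr_fun (g := LinearMap.id) ((Pi.basisFun R (Fin n ⊕ Fin n)).ext ?_) x
  rintro (i | i)
  · simpa [e] using (h i).1
  · simpa [f] using (h i).2

/-- A matrix that fixes all but the last `t` hyperbolic pairs is a product of `5 * t` transvections: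
two move the image of `e j` back to `e j`, and three more do the same for `f j`. -/
theorem isProd_of_forall_transvection [Finite (MaximalSpectrum R)]
    {S : Set (symplecticGroup (Fin n) R)} {C : ℕ}
    (hS : ∀ v a, IsUnimodular v → IsProd S C (transvection v a))
    (t : ℕ) (g : symplecticGroup (Fin n) R)
    (hg : ∀ i : Fin n, i.val + t < n → act g (e i) = e i ∧ act g (f i) = f i) :
    IsProd S (C * (5 * t)) g := by
  induction t generalizing g with
  | zero =>
    rw [eq_one_of_fixes fun i => hg i i.2]
    exact IsProd.one
  | succ t ih =>
    by_cases htn : n ≤ t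
    · exact (ih g fun i hi => by omega).mono (by gcongr; omega)
    have step : ∀ {N v a} {g : symplecticGroup (Fin n) R}, IsUnimodular v →
        IsProd S N (transvection v a * g) → IsProd S (C + N) g := by
      intro N v a g hv h
      simpa [transvection_neg] using (hS v (-a) hv).mul h
    let j : Fin n := ⟨n - (t + 1), by omega⟩
    let W : Submodule R (Fin n ⊕ Fin n → R) := perp R j
    have fixes : ∀ {v a} {g : symplecticGroup (Fin n) R}, v ∈ W →
        (∀ i : Fin n, i < j → act g (e i) = e i ∧ act g (f i) = f i) →
        ∀ i : Fin n, i < j → act (transvection v a * g) (e i) = e i ∧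
          act (transvection v a * g) (f i) = f i := by
      intro v a g hv h i hi
      simp [h i hi, hv i hi]
    have heW : (e j : _ → R) ∈ W := fun i hi => by
      simp [form_e_f, show j ≠ i by rintro rfl; exact lt_irrefl _ hi]
    have hfW : (f j : _ → R) ∈ W := fun i hi => by
      simp [form_f_e, show j ≠ i by rintro rfl; exact lt_irrefl _ hi]
    have preserves : ∀ {g : symplecticGroup (Fin n) R},
        (∀ i : Fin n, i < j → act g (e i) = e i ∧ act g (f i) = f i) →
        ∀ x ∈ W, act g x ∈ W := by
      intro g h x hx i hi
      have := hx i hi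
      rwa [← form_act g, ← form_act g x, (h i hi).1, (h i hi).2] at this
    have hg0 : ∀ i : Fin n, i < j → act g (e i) = e i ∧ act g (f i) = f i :=
      fun i hi => hg i (by have : i.val < n - (t + 1) := hi; omega)
    -- Move the image of `e j` back to `e j`.
    obtain ⟨u₁, hu₁, u₂, hu₂, a₁, a₂, h₁, h₂, he⟩ := exists_two_transvections_act_eq W
      (preserves hg0 _ heW) heW (preserves hg0 _ hfW) hfW (by simp [form_e_f]) (by simp [form_e_f])
    have hg1 := fixes (a := a₂) hu₂ (fixes (a := a₁) hu₁ hg0)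
    set g1 := transvection u₂ a₂ * (transvection u₁ a₁ * g) with hg1_def
    have he1 : act g1 (e j) = e j := by rw [hg1_def, ← mul_assoc, act_mul, he]
    -- Make the image `x` of `f j` orthogonal to `f j`; then `f j - e j` pairs to `1` with both.
    set a₃ := -form (act g1 (f j)) (f j) with ha₃
    have hg2 := fixes (a := a₃) heW hg1
    set g2 := transvection (e j) a₃ * g1 with hg2_def
    have he2 : act g2 (e j) = e j := by rw [hg2_def, act_mul, he1]; simp
    have hex : form (e j) (act g2 (f j)) = 1 := by
      nth_rewrite 1 [← he2]
      rw [form_act]; simp [form_e_f]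
    have hxf : form (act g2 (f j)) (f j) = 0 := by
      have : form (e j) (act g1 (f j)) = 1 := by
        nth_rewrite 1 [← he1]
        rw [form_act]; simp [form_e_f]
      simp [hg2_def, ha₃, this, form_e_f]
    have hxW := preserves hg2 _ hfW
    have hx1 : form (act g2 (f j)) (f j - e j) = 1 := by
      rw [map_sub, hxf, form_swap, hex]; simp
    have hx2 : form (f j - e j) (f j : _ → R) = -1 := by simp [form_e_f]
    obtain ⟨h₄, a₄, h₄'⟩ := exists_transvection_act_eq (hx1 ▸ isUnit_one)
    obtain ⟨h₅, a₅, h₅'⟩ := exists_transvection_act_eq (hx2 ▸ isUnit_one.neg)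
    have hg3 := fixes (a := a₄) (W.sub_mem (W.sub_mem hfW heW) hxW) hg2
    have hg4 := fixes (a := a₅) (W.sub_mem hfW (W.sub_mem hfW heW)) hg3
    have hfix := ih _ fun i hi => by
      rcases (show i ≤ j by
        rw [Fin.le_def]; change i.val ≤ n - (t + 1); omega).lt_or_eq with hij | rfl
      · exact hg4 i hij
      · constructor
        · rw [act_mul, act_mul, he2]
          have h6 : form (f j - e j - act g2 (f j)) (e j) = 0 := by
            rw [map_sub, LinearMap.sub_apply, form_swap (act g2 (f j)), hex]; simp [form_f_e]
          have h7 : form (f j - (f j - e j)) (e j : _ → R) = 0 := by simp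
          rw [act_transvection, act_transvection, h6, mul_zero, zero_smul, add_zero, h7, mul_zero,
            zero_smul, add_zero]
        · rw [act_mul, act_mul, h₄', h₅']
    exact (step h₁ (step h₂ (step (isUnimodular_e j) (step h₄ (step h₅ hfix))))).mono
      (by ring_nf; rfl)

/-! ### The upper bound -/

/-- The symplectic matrices `A` for which `x^⊥ ⊆ (A x)^⊥` modulo `m` for all vectors `x`; for a
maximal ideal `m` these are the matrices that are scalar modulo `m`. -/
def scalarMod (n : ℕ) (m : Ideal R) : Subgroup (symplecticGroup (Fin n) R) where
  carrier := {A | ∀ x u, form x u ∈ m → form (act A x) u ∈ m}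
  one_mem' x u h := by simpa using h
  mul_mem' {A B} hA hB x u h := by simpa using hA _ _ (hB _ _ h)
  inv_mem' {A} hA x u h := by
    rw [form_act_left, inv_inv, form_swap, neg_mem_iff]
    exact hA _ _ (by rwa [form_swap, neg_mem_iff])

theorem mem_scalarMod {m : Ideal R} {A : symplecticGroup (Fin n) R} :
    A ∈ scalarMod n m ↔ ∀ x u, form x u ∈ m → form (act A x) u ∈ m := Iff.rfl

instance (m : Ideal R) : (scalarMod n m).Normal where
  conj_mem A hA g x u h := by
    rw [act_mul, act_mul, form_act_left]
    exact hA _ _ (by simpa using h)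

theorem transvection_notMem_scalarMod (i : Fin n) {a : R} {m : Ideal R} (h : a ∉ m) :
    transvection (e i) a ∉ scalarMod n m := fun hm => h <| by
  simpa [form_e_f] using mem_scalarMod.1 hm (f i) (f i) (by simp)

theorem exists_notMem_scalarMod {S : Set (symplecticGroup (Fin n) R)} (i : Fin n)
    (hS : Subgroup.normalClosure S = ⊤) {m : Ideal R} (hm : m ≠ ⊤) :
    ∃ A ∈ S, A ∉ scalarMod n m := by
  by_contra! h
  have : Subgroup.normalClosure S ≤ scalarMod n m := Subgroup.normalClosure_le_normal h
  rw [hS] at this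
  exact transvection_notMem_scalarMod i ((Ideal.ne_top_iff_one m).1 hm) (this trivial)

/-- The orthogonal complement of the `i`-th hyperbolic pair. -/
def pairPerp (R : Type*) [CommRing R] {n : ℕ} (i : Fin n) : Submodule R (Fin n ⊕ Fin n → R) :=
  LinearMap.ker (form (e i)) ⊓ LinearMap.ker (form (f i))

theorem mem_pairPerp {i : Fin n} {x : Fin n ⊕ Fin n → R} :
    x ∈ pairPerp R i ↔ form (e i) x = 0 ∧ form (f i) x = 0 := by
  simp [pairPerp]

theorem e_mem_pairPerp {i j : Fin n} (h : i ≠ j) : (e j : _ → R) ∈ pairPerp R i := by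
  simp [mem_pairPerp, form_f_e, h]

theorem f_mem_pairPerp {i j : Fin n} (h : i ≠ j) : (f j : _ → R) ∈ pairPerp R i := by
  simp [mem_pairPerp, form_e_f, h]

/-- Over a principal ideal domain every vector is a multiple of a unimodular one. -/
theorem exists_eq_smul_of_mem_pairPerp [IsDomain R] [IsPrincipalIdealRing R] {i j : Fin n}
    (hij : i ≠ j) {w : Fin n ⊕ Fin n → R} (hw : w ∈ pairPerp R i) :
    ∃ γ : R, ∃ u ∈ pairPerp R i, ∃ y ∈ pairPerp R i, w = γ • u ∧ form u y = 1 := by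
  let I : Ideal R := (pairPerp R i).map (form w)
  obtain ⟨γ, hγ⟩ := (IsPrincipalIdealRing.principal I).principal
  have hf0 : w (Sum.inl i) = 0 := by
    rw [← form_f_right w, form_swap, (mem_pairPerp.1 hw).2, neg_zero]
  have he0 : w (Sum.inr i) = 0 := by
    have := (mem_pairPerp.1 hw).1
    rwa [form_swap, form_e_right, neg_neg] at this
  have hI : ∀ l, w l ∈ I := by
    rintro (l | l) <;> by_cases h : i = l
    · subst h; rw [hf0]; exact I.zero_mem
    · exact ⟨f l, f_mem_pairPerp h, form_f_right w l⟩
    · subst h; rw [he0]; exact I.zero_mem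
    · rw [← neg_mem_iff]
      exact ⟨e l, e_mem_pairPerp h, form_e_right w l⟩
  by_cases hγ0 : γ = 0
  · refine ⟨0, e j, e_mem_pairPerp hij, f j, f_mem_pairPerp hij, ?_, by simp [form_e_f]⟩
    ext l
    have := hI l
    rw [hγ, hγ0] at this
    simpa using this
  · have hdiv : ∀ l, ∃ c, w l = γ * c := fun l => by
      have := hI l
      rw [hγ] at this
      obtain ⟨c, hc⟩ := Ideal.mem_span_singleton'.1 this
      exact ⟨c, by rw [← hc, mul_comm]⟩
    choose u hu using hdiv
    have hwu : w = γ • u := funext hu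
    have hγI : γ ∈ I := hγ ▸ Submodule.mem_span_singleton_self γ
    obtain ⟨y, hy, hyγ⟩ := hγI
    refine ⟨γ, u, ?_, y, hy, hwu, ?_⟩
    · rw [hwu, mem_pairPerp] at hw
      simpa [mem_pairPerp, hγ0] using hw
    · rw [hwu] at hyγ
      exact mul_left_cancel₀ hγ0 (by simpa using hyγ)

/-- A single vector `p` that a matrix `A` moves out of its line modulo all maximal ideals of a set
modulo which `A` is not scalar. This is witnessed by a vector `u` orthogonal to `p` but not to
`A p`. -/
theorem exists_moved_vector [Finite (MaximalSpectrum R)] (i : Fin n)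
    {A : symplecticGroup (Fin n) R} {M : Set (MaximalSpectrum R)}
    (hA : ∀ m ∈ M, A ∉ scalarMod n m.asIdeal) :
    ∃ p u y, form p y = 1 ∧
      ∀ m ∈ M, form p u ∈ m.asIdeal ∧ form (act A p) u ∉ m.asIdeal := by
  have key : ∀ m : MaximalSpectrum R, ∃ x u y, form x y ∉ m.asIdeal ∧
      (m ∈ M → form x u ∈ m.asIdeal ∧ form (act A x) u ∉ m.asIdeal) := by
    intro m
    by_cases hm : m ∈ M
    · have := hA m hm
      rw [mem_scalarMod] at this
      push Not at this
      obtain ⟨x, u, h1, h2⟩ := this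
      exact ⟨x, u, act A⁻¹ u, by rwa [← form_act_left], fun _ => ⟨h1, h2⟩⟩
    · exact ⟨e i, 0, f i, notMem_of_eq_one (by simp [form_e_f]) m, fun h => absurd h hm⟩
  choose x u y h1 h2 using key
  obtain ⟨p, -, hp⟩ := exists_forall_map_sub_mem x
  obtain ⟨u', -, hu'⟩ := exists_forall_map_sub_mem u
  obtain ⟨y', -, hy'⟩ := exists_forall_map_sub_mem y
  have approx : ∀ (B : symplecticGroup (Fin n) R) (z : MaximalSpectrum R → Fin n ⊕ Fin n → R) z',
      (∀ (φ : (Fin n ⊕ Fin n → R) →ₗ[R] R) m, φ z' - φ (z m) ∈ m.asIdeal) →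
      ∀ m, form (act B p) z' - form (act B (x m)) (z m) ∈ m.asIdeal := by
    intro B z z' hz m
    have e1 := hz (form (act B p)) m
    have e2 := hp ((form.flip (z m)).comp (act B)) m
    simpa using Ideal.add_mem _ e1 e2
  have hunit : IsUnit (form p y') := isUnit_of_forall_notMem fun m hm => h1 m <| by
    have := approx 1 y y' hy' m
    rw [act_one, act_one] at this
    exact (Submodule.sub_mem_iff_right _ hm).1 this
  obtain ⟨b, hb⟩ := isUnimodular_of_isUnit hunit
  refine ⟨p, u', b, hb, fun m hm => ⟨?_, fun h => (h2 m hm).2 ?_⟩⟩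
  · have := approx 1 u u' hu' m
    rw [act_one, act_one] at this
    exact (Submodule.sub_mem_iff_left _ (h2 m hm).1).1 this
  · exact (Submodule.sub_mem_iff_right _ h).1 (approx A u u' hu' m)

/-- Boundedly many conjugates of a single matrix give all transvections along `e k` with parameter
in an ideal that is contained in no maximal ideal modulo which the matrix is not scalar. -/
theorem exists_isProd_transvection [IsDomain R] [IsPrincipalIdealRing R]
    [Finite (MaximalSpectrum R)] {S : Set (symplecticGroup (Fin n) R)}
    {A : symplecticGroup (Fin n) R} (hAS : IsProd S 1 A) {i j k : Fin n} (hij : i ≠ j)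
    (hik : i ≠ k) (hjk : j ≠ k) {M : Set (MaximalSpectrum R)}
    (hA : ∀ m ∈ M, A ∉ scalarMod n m.asIdeal) :
    ∃ c : R, (∀ m ∈ M, c ∉ m.asIdeal) ∧ ∀ a, IsProd S 24 (transvection (e k) (a * c)) := by
  obtain ⟨p, u, y, hpy, hpu⟩ := exists_moved_vector i hA
  -- Conjugate so that `p` becomes `e i`.
  obtain ⟨u₁, -, u₂, -, a₁, a₂, -, -, hp⟩ := exists_two_transvections_act_eq ⊤
    (Submodule.mem_top (x := p)) (Submodule.mem_top (x := e i)) (Submodule.mem_top (x := y))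
    (Submodule.mem_top (x := f i)) hpy (by simp [form_e_f])
  set h := transvection u₂ a₂ * transvection u₁ a₁
  have hp' : act h⁻¹ (e i) = p := by rw [← hp, act_inv_act]
  set v := act h (act A p) with hv
  set α := -form (f i) v with hα
  set β := form (e i) v with hβ
  have hw : v - α • e i - β • f i ∈ pairPerp R i := by
    simp [mem_pairPerp, form_e_f, form_f_e, α, β]
  obtain ⟨γ, w, hwW, z, hzW, hγ, hwz⟩ := exists_eq_smul_of_mem_pairPerp hij hw
  -- Conjugate so that the component of `v` orthogonal to `e i` and `f i` becomes `γ • e j`.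
  obtain ⟨u₃, hu₃, u₄, hu₄, a₃, a₄, -, -, hwj⟩ := exists_two_transvections_act_eq (pairPerp R i)
    hwW (e_mem_pairPerp hij) hzW (f_mem_pairPerp hij) hwz (by simp [form_e_f])
  rw [mem_pairPerp, form_swap, neg_eq_zero, form_swap (f i), neg_eq_zero] at hu₃ hu₄
  set g := transvection u₄ a₄ * transvection u₃ a₃
  have hge : act g (e i) = e i := by simp [g, hu₃, hu₄]
  have hgf : act g (f i) = f i := by simp [g, hu₃, hu₄]
  have hgv : act g v = α • e i + β • f i + γ • e j := by
    rw [← hwj, ← map_smul, ← hγ]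
    simp [hge, hgf]
  have hge' : act g⁻¹ (e i) = e i := by rw [← hge, act_inv_act, hge]
  obtain ⟨d, hd⟩ := (IsPrincipalIdealRing.principal (Ideal.span {γ, β})).principal
  have hdm : d ∈ Ideal.span {γ, β} := hd ▸ Submodule.mem_span_singleton_self d
  obtain ⟨x, x', hxx'⟩ := Ideal.mem_span_pair.1 hdm
  have hB : IsProd S 1 (g * (h * A * h⁻¹) * g⁻¹)⁻¹ := ((hAS.conj h).conj g).inv
  have hBv : act (g * (h * A * h⁻¹) * g⁻¹)⁻¹ (act g v) = e i := by
    have : act (g * (h * A * h⁻¹) * g⁻¹) (e i) = act g v := by simp [hge', hp', hv]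
    rw [← this, act_inv_act]
  refine ⟨d ^ 2, fun m hm hdm => ?_, isProd_transvection_mul_sq hjk
    (isProd_eichler hij hik (v := act g v)
      (y := -d • f i + (x * α) • f j - (x' * α) • e i) hB hBv ?_ ?_ ?_ ?_)⟩
  · replace hdm := m.isMaximal.isPrime.mem_of_pow_mem 2 hdm
    have hle : Ideal.span {γ, β} ≤ m.asIdeal := by
      rw [hd]
      exact (Ideal.span_singleton_le_iff_mem _).2 hdm
    have hγm : γ ∈ m.asIdeal := hle (Ideal.subset_span (by simp))
    have hβm : β ∈ m.asIdeal := hle (Ideal.subset_span (by simp))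
    obtain ⟨h1, h2⟩ := hpu m hm
    refine h2 ?_
    have e1 : form (e i) (act h u) = form p u := by
      rw [← hp, form_act]
    have e2 : form (act A p) u = form v (act h u) := by rw [hv, form_act]
    have e3 : v = γ • w + α • e i + β • f i := by rw [← hγ]; module
    rw [e2, e3]
    simp only [map_add, map_smul, LinearMap.add_apply, LinearMap.smul_apply, smul_eq_mul, e1]
    exact Ideal.add_mem _ (Ideal.add_mem _ (Ideal.mul_mem_right _ _ hγm)
      (Ideal.mul_mem_left _ _ h1)) (Ideal.mul_mem_right _ _ hβm)
  · simp [hgv, form_e_f, hik.symm]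
  · rw [hgv, ← hxx']
    simp [form_e_f, form_f_e, hij, hij.symm]
    ring
  · simp [form_f_e, hik, hjk]
  · simp [form_f_e, hij.symm]

/-- The transvections along `v` as a homomorphism on the additive group. -/
def transvectionHom (v : Fin n ⊕ Fin n → R) : Multiplicative R →* symplecticGroup (Fin n) R where
  toFun a := transvection v a.toAdd
  map_one' := transvection_zero v
  map_mul' a b := transvection_add v a.toAdd b.toAdd

/-- If every maximal ideal has an element of the finite set `T ⊆ S` that is not scalar modulo it,
then the diameter is at most linear in the size of `T`. -/
theorem isProd_of_forall_exists_notMem_scalarMod [IsDomain R] [IsPrincipalIdealRing R]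
    [Finite (MaximalSpectrum R)] (hn : 3 ≤ n) {S : Set (symplecticGroup (Fin n) R)}
    {T : Finset (symplecticGroup (Fin n) R)} (hTS : ↑T ⊆ S)
    (hT : ∀ m : MaximalSpectrum R, ∃ A ∈ T, A ∉ scalarMod n m.asIdeal)
    (g : symplecticGroup (Fin n) R) : IsProd S (24 * T.card * (5 * n)) g := by
  classical
  let i : Fin n := ⟨0, by omega⟩
  let j : Fin n := ⟨1, by omega⟩
  let k : Fin n := ⟨2, by omega⟩
  have hij : i ≠ j := by simp [i, j]
  have hik : i ≠ k := by simp [i, k]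
  have hjk : j ≠ k := by simp [j, k]
  have key : ∀ A, ∃ c : R, A ∈ T →
      ((∀ m : MaximalSpectrum R, A ∉ scalarMod n m.asIdeal → c ∉ m.asIdeal) ∧
        ∀ a, IsProd S 24 (transvection (e k) (a * c))) := by
    intro A
    by_cases hA : A ∈ T
    · obtain ⟨c, hc⟩ := exists_isProd_transvection (IsProd.of_mem (hTS hA)) hij hik hjk
        (M := {m | A ∉ scalarMod n m.asIdeal}) fun m hm => hm
      exact ⟨c, fun _ => hc⟩
    · exact ⟨0, fun h => absurd h hA⟩
  choose c hc using key
  have htop : Ideal.span (c '' (T : Set _)) = ⊤ := by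
    by_contra h
    obtain ⟨m, hm, hle⟩ := Ideal.exists_le_maximal _ h
    obtain ⟨A, hAT, hA⟩ := hT ⟨m, hm⟩
    exact (hc A hAT).1 ⟨m, hm⟩ hA (hle (Ideal.subset_span ⟨A, hAT, rfl⟩))
  have hk : ∀ r, IsProd S (24 * T.card) (transvection (e k) r) := by
    intro r
    have hr : r ∈ Ideal.span (c '' (T : Set _)) := htop ▸ Submodule.mem_top
    obtain ⟨b, hb⟩ := (Submodule.mem_span_image_finset_iff_exists_fun R).1 hr
    rw [← hb]
    have := IsProd.finset_prod Finset.univ (transvectionHom (e k)) (fun A : T => b A • c A)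
      fun A _ => (hc A A.2).2 (b A)
    rwa [Finset.card_univ, Fintype.card_coe] at this
  refine isProd_of_forall_transvection (fun v a ⟨y, hy⟩ => ?_) n g fun i hi => by omega
  obtain ⟨u₁, -, u₂, -, a₁, a₂, -, -, hv⟩ := exists_two_transvections_act_eq ⊤
    (Submodule.mem_top (x := v)) (Submodule.mem_top (x := e k)) (Submodule.mem_top (x := y))
    (Submodule.mem_top (x := f k)) hy (by simp [form_e_f])
  refine IsProd.of_conj (transvection u₂ a₂ * transvection u₁ a₁) ?_
  rw [conj_transvection, hv]
  exact hk a

theorem normalClosure_eq_top [IsDomain R] [IsPrincipalIdealRing R]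
    [Finite (MaximalSpectrum R)] (hn : 3 ≤ n) {S : Set (symplecticGroup (Fin n) R)}
    (hfin : S.Finite) (hS : ∀ m : MaximalSpectrum R, ∃ A ∈ S, A ∉ scalarMod n m.asIdeal) :
    Subgroup.normalClosure S = ⊤ :=
  (Subgroup.eq_top_iff' _).2 fun g => (isProd_of_forall_exists_notMem_scalarMod hn
    (T := hfin.toFinset) (by simp) (by simpa using hS) g).mem_normalClosure

theorem Delta_symplecticGroup_le [IsDomain R] [IsPrincipalIdealRing R]
    [Finite (MaximalSpectrum R)] (hn : 3 ≤ n) (k : ℕ) :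
    Delta k (symplecticGroup (Fin n) R) ≤
      ((24 * min (Nat.card (MaximalSpectrum R)) k * (5 * n) : ℕ) : WithBot ℕ∞) := by
  classical
  cases nonempty_fintype (MaximalSpectrum R)
  refine sSup_le ?_
  rintro _ ⟨S, hSk, hS, rfl⟩
  choose A hAS hA using fun m : MaximalSpectrum R =>
    exists_notMem_scalarMod ⟨0, by omega⟩ hS m.isMaximal.ne_top
  have hTS : ↑(Finset.univ.image A) ⊆ S := by
    simpa [Set.range_subset_iff] using hAS
  have hcard : (Finset.univ.image A).card ≤ min (Nat.card (MaximalSpectrum R)) k := by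
    refine le_min ?_ ?_
    · rw [Nat.card_eq_fintype_card]
      exact Finset.card_image_le
    · have := (Set.encard_le_encard hTS).trans hSk
      rw [Set.encard_coe_eq_coe_finsetCard] at this
      exact_mod_cast this
  have h := diam_le (S := S) fun g => (isProd_of_forall_exists_notMem_scalarMod hn hTS
    (fun m => ⟨A m, by simp, hA m⟩) g).mono
      (Nat.mul_le_mul_right _ (Nat.mul_le_mul_left 24 hcard))
  exact WithBot.coe_le_coe.2 h

/-! ### The lower bound -/

theorem rank_add_le {ι K : Type*} [Fintype ι] [Field K] (A B : Matrix ι ι K) :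
    (A + B).rank ≤ A.rank + B.rank := by
  classical
  rw [Matrix.rank, Matrix.rank, Matrix.rank, Matrix.mulVecLin_add]
  refine (Submodule.finrank_mono ?_).trans (Submodule.finrank_add_le_finrank_add_finrank _ _)
  exact LinearMap.range_add_le _ _

/-- The rank of `A - 1` after base change along `φ` to the field `K`. -/
noncomputable def defect {K : Type*} [Field K] (φ : R →+* K) (A : symplecticGroup (Fin n) R) : ℕ :=
  (A.1.map φ - 1).rank

variable {K : Type*} [Field K] (φ : R →+* K)

@[simp]
theorem defect_one : defect φ (1 : symplecticGroup (Fin n) R) = 0 := by simp [defect]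

theorem defect_mul_le (A B : symplecticGroup (Fin n) R) :
    defect φ (A * B) ≤ defect φ A + defect φ B := by
  have : (A * B).1.map φ - 1 = (A.1.map φ - 1) * B.1.map φ + (B.1.map φ - 1) := by
    rw [Submonoid.coe_mul, Matrix.map_mul, sub_mul, one_mul]
    abel
  rw [defect, this]
  exact (rank_add_le _ _).trans (Nat.add_le_add_right (Matrix.rank_mul_le_left _ _) _)

theorem defect_conj_le (A g : symplecticGroup (Fin n) R) :
    defect φ (g * A * g⁻¹) ≤ defect φ A := by
  have h1 : g.1.map φ * (g⁻¹).1.map φ = 1 := by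
    rw [← Matrix.map_mul, ← Submonoid.coe_mul, mul_inv_cancel]; simp
  have : (g * A * g⁻¹).1.map φ - 1 = g.1.map φ * (A.1.map φ - 1) * (g⁻¹).1.map φ := by
    rw [Submonoid.coe_mul, Submonoid.coe_mul, Matrix.map_mul, Matrix.map_mul, mul_sub, sub_mul,
      mul_one, h1]
  rw [defect, this]
  exact (Matrix.rank_mul_le_left _ _).trans (Matrix.rank_mul_le_right _ _)

theorem defect_inv_le (A : symplecticGroup (Fin n) R) : defect φ A⁻¹ ≤ defect φ A := by
  have h1 : (A⁻¹).1.map φ * A.1.map φ = 1 := by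
    rw [← Matrix.map_mul, ← Submonoid.coe_mul, inv_mul_cancel]; simp
  have : (A⁻¹).1.map φ - 1 = -(A⁻¹).1.map φ * (A.1.map φ - 1) := by
    rw [neg_mul, mul_sub, h1, mul_one, neg_sub]
  rw [defect, this]
  exact Matrix.rank_mul_le_right _ _

theorem coe_transvection (v : Fin n ⊕ Fin n → R) (a : R) :
    (transvection v a).1 = 1 + vecMulVec (a • v) (-(v ᵥ* J (Fin n) R)) := by
  refine Matrix.toLin'.injective (LinearMap.ext fun x => ?_)
  have h : Matrix.toLin' (transvection v a).1 x = act (transvection v a) x := rfl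
  rw [h, act_transvection, Matrix.toLin'_apply, Matrix.add_mulVec, Matrix.one_mulVec,
    Matrix.vecMulVec_mulVec, form_apply, neg_dotProduct, Matrix.dotProduct_mulVec]
  ext l
  simp
  ring

theorem map_transvection_sub_one (v : Fin n ⊕ Fin n → R) (a : R) :
    (transvection v a).1.map φ - 1 = vecMulVec (φ a • (φ ∘ v)) (φ ∘ (-(v ᵥ* J (Fin n) R))) := by
  rw [coe_transvection]
  ext l l'
  simp [Matrix.one_apply, Matrix.vecMulVec_apply, mul_assoc]

theorem defect_transvection_le_one (v : Fin n ⊕ Fin n → R) (a : R) :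
    defect φ (transvection v a) ≤ 1 := by
  rw [defect, map_transvection_sub_one]
  exact Matrix.rank_vecMulVec_le _ _

theorem defect_transvection_eq_zero (v : Fin n ⊕ Fin n → R) {a : R} (h : φ a = 0) :
    defect φ (transvection v a) = 0 := by
  simp [defect, map_transvection_sub_one, h]

theorem sum_defect_list_prod_le {ι : Type*} [Fintype ι] {K : ι → Type*} [∀ i, Field (K i)]
    (φ : ∀ i, R →+* K i) (w : List (symplecticGroup (Fin n) R))
    (h : ∀ x ∈ w, ∑ i, defect (φ i) x ≤ 1) : ∑ i, defect (φ i) w.prod ≤ w.length := by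
  induction w with
  | nil => simp
  | cons a w ih =>
    calc ∑ i, defect (φ i) (a :: w).prod ≤ ∑ i, (defect (φ i) a + defect (φ i) w.prod) :=
          Finset.sum_le_sum fun i _ => by simpa using defect_mul_le (φ i) a w.prod
      _ = ∑ i, defect (φ i) a + ∑ i, defect (φ i) w.prod := Finset.sum_add_distrib
      _ ≤ 1 + w.length := Nat.add_le_add (h a (by simp)) (ih fun x hx => h x (by simp [hx]))
      _ = (a :: w).length := by simp [add_comm]

/-- A symplectic matrix that has no eigenvalue `1` modulo any maximal ideal. -/
def fixedPointFree (n : ℕ) (R : Type*) [CommRing R] : symplecticGroup (Fin n) R :=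
  ⟨fromBlocks 1 1 (-1) 0, by simp [SymplecticGroup.fromBlocks_mem_iff]⟩

theorem defect_fixedPointFree : defect φ (fixedPointFree n R) = 2 * n := by
  have h : (fromBlocks 1 1 (-1) 0 : Matrix (Fin n ⊕ Fin n) (Fin n ⊕ Fin n) K) - 1 =
      fromBlocks 0 1 (-1) (-1) := by
    rw [← fromBlocks_one, sub_eq_add_neg, fromBlocks_neg, fromBlocks_add]; simp
  have h2 : (fromBlocks 0 1 (-1) (-1) : Matrix (Fin n ⊕ Fin n) (Fin n ⊕ Fin n) K) *
      fromBlocks (-1) (-1) 1 0 = 1 := by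
    rw [fromBlocks_multiply]; simp
  rw [defect, fixedPointFree, fromBlocks_map]
  simp only [Matrix.map_one φ φ.map_zero φ.map_one, Matrix.map_zero φ φ.map_zero]
  rw [show (-1 : Matrix (Fin n) (Fin n) R).map φ = -1 by
    rw [Matrix.map_neg φ (map_neg φ), Matrix.map_one φ φ.map_zero φ.map_one], h,
    Matrix.rank_of_isUnit _ (IsUnit.of_mul_eq_one _ h2)]
  simp [two_mul]

/-- The maximal ideals are divided into `k` classes, and the generating set consists of `k`
transvections such that the `i`-th one is nontrivial exactly modulo the ideals of the `i`-th
class. -/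
theorem le_Delta_symplecticGroup [IsDomain R] [IsPrincipalIdealRing R]
    [Finite (MaximalSpectrum R)] (hn : 3 ≤ n) {k : ℕ} (hk : 1 ≤ k)
    (hkq : k ≤ Nat.card (MaximalSpectrum R)) :
    ((2 * n * k : ℕ) : WithBot ℕ∞) ≤ Delta k (symplecticGroup (Fin n) R) := by
  classical
  cases nonempty_fintype (MaximalSpectrum R)
  have : Nonempty (Fin k) := ⟨⟨0, hk⟩⟩
  obtain ⟨c, hc⟩ : ∃ c : MaximalSpectrum R → Fin k, Function.Surjective c := by
    obtain ⟨ι⟩ : Nonempty (Fin k ↪ MaximalSpectrum R) :=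
      Function.Embedding.nonempty_of_card_le (by simpa [Nat.card_eq_fintype_card] using hkq)
    exact ⟨_, Function.invFun_surjective ι.injective⟩
  choose μ hμ using hc
  choose r hr using fun i : Fin k =>
    exists_forall_sub_mem (R := R) fun m => if c m = i then 1 else 0
  have hr1 : ∀ m, r (c m) ∉ m.asIdeal := fun m h => by
    have := hr (c m) m
    rw [if_pos rfl] at this
    exact notMem_of_eq_one rfl m ((Submodule.sub_mem_iff_right _ h).1 this)
  have hr0 : ∀ m i, c m ≠ i → r i ∈ m.asIdeal := fun m i h => by
    simpa [h] using hr i m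
  let o : Fin n := ⟨0, by omega⟩
  let s : Fin k → symplecticGroup (Fin n) R := fun i => transvection (e o) (r i)
  refine le_trans ?_ (le_sSup ⟨Set.range s, ?_, ?_, rfl⟩)
  · let K := fun i : Fin k => R ⧸ (μ i).asIdeal
    have hmax := fun i : Fin k => (μ i).isMaximal
    let _ : ∀ i, Field (K i) := fun i => Ideal.Quotient.field _
    let φ : ∀ i, R →+* K i := fun i => Ideal.Quotient.mk (μ i).asIdeal
    refine WithBot.coe_le_coe.2 (le_diam (fixedPointFree n R) fun w hw hwg => ?_)
    -- A conjugate of a generator contributes to the defect modulo only one of the ideals `μ i`.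
    have hone : ∀ x ∈ w, ∑ i, defect (φ i) x ≤ 1 := by
      intro x hx
      have hs : ∀ l i, defect (φ i) (s l) ≤ if i = l then 1 else 0 := by
        intro l i
        by_cases hil : i = l
        · rw [if_pos hil]
          exact defect_transvection_le_one _ _ _
        · rw [if_neg hil, nonpos_iff_eq_zero]
          exact defect_transvection_eq_zero _ _
            (Ideal.Quotient.eq_zero_iff_mem.2 (hr0 _ _ (by rwa [hμ])))
      obtain ⟨a, ha, hax⟩ := Group.mem_conjugatesOfSet_iff.1 (hw x hx)
      obtain ⟨g, rfl⟩ := isConj_iff.1 hax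
      obtain ⟨l, hl⟩ : ∃ l, ∀ i, defect (φ i) a ≤ defect (φ i) (s l) := by
        rcases ha with ⟨l, rfl⟩ | ⟨l, hl⟩
        · exact ⟨l, fun i => le_rfl⟩
        · exact ⟨l, fun i => by rw [hl]; simpa using defect_inv_le (φ i) a⁻¹⟩
      calc ∑ i, defect (φ i) (g * a * g⁻¹) ≤ ∑ i, if i = l then 1 else 0 :=
            Finset.sum_le_sum fun i _ =>
              (defect_conj_le _ _ _).trans ((hl i).trans (hs l i))
        _ = 1 := by simp
    calc 2 * n * k = ∑ i, defect (φ i) w.prod := by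
          rw [hwg]; simp [defect_fixedPointFree, mul_comm]
      _ ≤ w.length := sum_defect_list_prod_le φ w hone
  · have := Set.encard_le_encard (Set.image_univ (f := s)).symm.subset
    refine this.trans ((Set.encard_image_le _ _).trans ?_)
    simp
  · exact normalClosure_eq_top hn (Set.finite_range s) fun m =>
      ⟨s (c m), ⟨c m, rfl⟩, transvection_notMem_scalarMod o (hr1 m)⟩

end SymplecticTransvection

theorem mainTheorem1 (R : Type*) [CommRing R] [IsDomain R] [IsPrincipalIdealRing R]
    (q : ℕ) (hq : {m : Ideal R | m.IsMaximal}.encard = (q : ℕ∞))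
    (n : ℕ) (hn : 3 ≤ n) (k : ℕ) (hk : 1 ≤ k) :
    ConjWordNorm.Delta k (Matrix.symplecticGroup (Fin n) R)
        ≤ ((576 * (3 * n - 2) * min q (5 * n * k) : ℕ) : WithBot ℕ∞) ∧
    (k ≤ q →
      ((2 * n * k : ℕ) : WithBot ℕ∞)
        ≤ ConjWordNorm.Delta k (Matrix.symplecticGroup (Fin n) R)) ∧
    (q + 1 ≤ k →
      ((2 * n * q : ℕ) : WithBot ℕ∞)
        ≤ ConjWordNorm.Delta k (Matrix.symplecticGroup (Fin n) R)) := by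
  have hfin : {m : Ideal R | m.IsMaximal}.Finite := Set.finite_of_encard_eq_coe hq
  have : Finite (MaximalSpectrum R) :=
    have : Finite {m : Ideal R // m.IsMaximal} := hfin.to_subtype
    Finite.of_equiv _ (MaximalSpectrum.equivSubtype R).symm
  have hcard : Nat.card (MaximalSpectrum R) = q := by
    rw [Nat.card_congr (MaximalSpectrum.equivSubtype R)]
    change Nat.card ↥{m : Ideal R | m.IsMaximal} = q
    rw [Nat.card_coe_set_eq, Set.ncard, hq, ENat.toNat_natCast]
  refine ⟨(SymplecticTransvection.Delta_symplecticGroup_le hn k).trans ?_, fun hkq =>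
    SymplecticTransvection.le_Delta_symplecticGroup hn hk (hcard ▸ hkq), fun hqk => ?_⟩
  · rw [hcard]
    have hmin : min q k ≤ min q (5 * n * k) :=
      min_le_min_left _ (Nat.le_mul_of_pos_left _ (by omega))
    have hc : 24 * (5 * n) ≤ 576 * (3 * n - 2) := by omega
    have h : 24 * min q k * (5 * n) ≤ 576 * (3 * n - 2) * min q (5 * n * k) := by
      rw [mul_right_comm]
      exact Nat.mul_le_mul hc hmin
    exact_mod_cast h
  · -- A domain is nontrivial, so that it has a maximal ideal.
    have hq1 : 1 ≤ q := hcard ▸ Nat.card_pos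
    exact (SymplecticTransvection.le_Delta_symplecticGroup hn hq1 hcard.ge).trans
      (ConjWordNorm.Delta_mono (by omega))
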